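/- For a compact Hausdorff space $K$ and a closed subspace $L\subset K$, let $C(K)$ be the Banach space of continuous real-valued functions on $K$ with the supremum norm. An extension operator is a bounded linear operator $T:C(L)\to C(K)$ such that $Tf$ extends $f$ for every $f\in C(L)$. Put $$\eta(L,K)=\inf\{\|T\| : T:C(L)\to C(K)\text{ is an extension operator}\},$$ with $\eta(L,K)=\infty$ if there is no extension operator. For a set $X$ and a natural number $n$, let $$\sigma_n(2^X)=\{\chi_A\in\{0,1\}^X : A\subset X,\ |A|\le n\},$$ a compact subspace of $\{0,1\}^X$ with the product topology, where $\chi_A$ is the characteristic function of $A$. Let $m\ge 0$ be an integer and let $X$ be a set with $|X|\ge\aleph_m$. Then $$\eta\big(\sigma_m(2^X),\sigma_{m+1}(2^X)\big)=2^{m+1}-1.$$ -/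

import Mathlib

open scoped ENNReal

/-- A bounded linear operator `T : C(L) → C(K)`, for `L ⊆ K`, is an extension operator if `T f`
extends `f` for every `f ∈ C(L)`. The spaces `C(L, ℝ)` and `C(K, ℝ)` carry the supremum norm. -/
def IsExtensionOperator {Z : Type*} [TopologicalSpace Z] {L K : Set Z}
    [CompactSpace L] [CompactSpace K] (hLK : L ⊆ K) (T : C(L, ℝ) →L[ℝ] C(K, ℝ)) : Prop :=
  ∀ (f : C(L, ℝ)) (x : L), T f (Set.inclusion hLK x) = f x

/-- The number `η(L, K)`: the infimum of the operator norms `‖T‖` of all extension operators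
`T : C(L) → C(K)`, with the value `∞` if there is none. -/
noncomputable def eta {Z : Type*} [TopologicalSpace Z] (L K : Set Z)
    [CompactSpace L] [CompactSpace K] (hLK : L ⊆ K) : ℝ≥0∞ :=
  ⨅ (T : C(L, ℝ) →L[ℝ] C(K, ℝ)) (_ : IsExtensionOperator hLK T), ENNReal.ofReal ‖T‖

/-- The space `σ_n(2^X)` of characteristic functions of subsets of `X` with at most `n` elements,
as a subset of `{0,1}^X` with the product topology. -/
def sigmaSpace (n : ℕ) (X : Type*) : Set (X → Bool) :=
  {f | ∃ A : Set X, A.encard ≤ n ∧ f = A.boolIndicator}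

theorem sigmaSpace_mono {m n : ℕ} (h : m ≤ n) (X : Type*) : sigmaSpace m X ⊆ sigmaSpace n X := by
  rintro f ⟨A, hA, rfl⟩
  exact ⟨A, hA.trans (by exact_mod_cast h), rfl⟩

theorem mem_sigmaSpace_iff {n : ℕ} {X : Type*} {f : X → Bool} :
    f ∈ sigmaSpace n X ↔ {x | f x = true}.encard ≤ n := by
  constructor
  · rintro ⟨A, hA, rfl⟩
    have : {x | A.boolIndicator x = true} = A := by
      ext x
      exact (Set.mem_iff_boolIndicator A x).symm
    rwa [this]
  · intro h
    refine ⟨{x | f x = true}, h, ?_⟩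
    funext x
    by_cases hx : f x = true <;> simp [Set.boolIndicator, hx]

theorem isClosed_sigmaSpace (n : ℕ) (X : Type*) : IsClosed (sigmaSpace n X) := by
  rw [← isOpen_compl_iff, isOpen_iff_mem_nhds]
  intro f hf
  rw [Set.mem_compl_iff, mem_sigmaSpace_iff, not_le] at hf
  have hf' : ((n + 1 : ℕ) : ℕ∞) ≤ {x | f x = true}.encard := by
    rw [Nat.cast_add, Nat.cast_one]
    exact Order.add_one_le_of_lt hf
  obtain ⟨t, ht, htc⟩ := Set.exists_subset_encard_eq hf'
  have htf : t.Finite := Set.finite_of_encard_eq_coe htc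
  have hopen : IsOpen {g : X → Bool | ∀ x ∈ t, g x = true} := by
    have : {g : X → Bool | ∀ x ∈ t, g x = true} = t.pi fun _ => {true} := by
      ext g
      simp [Set.mem_pi]
    rw [this]
    exact isOpen_set_pi htf fun _ _ => isOpen_discrete _
  refine Filter.mem_of_superset (hopen.mem_nhds fun x hx => ht hx) ?_
  intro g hg
  rw [Set.mem_compl_iff, mem_sigmaSpace_iff, not_le]
  have h1 : t.encard ≤ {x | g x = true}.encard := Set.encard_le_encard hg
  rw [htc] at h1
  exact lt_of_lt_of_le (by exact_mod_cast Nat.lt_succ_self n) h1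

instance instCompactSpaceSigmaSpace (n : ℕ) (X : Type*) : CompactSpace (sigmaSpace n X) :=
  isCompact_iff_compactSpace.mp (isClosed_sigmaSpace n X).isCompact

/-! Write `∏ x ∈ S, sigmaCoord n x` as the monomial of `S`; it takes the value 1 at `A` exactly when
`S ⊆ A`. Upper bound: at an `(m+1)`-set, the alternating sum over its `2 ^ (m + 1) - 1` proper
subsets is the extension whose top Möbius coefficient vanishes. It fixes monomials of degree at most
`m`, and density of their span gives continuity. Lower bound: continuity of `T` of each monomial at
sets of size at most `m` defines a set mapping. A free set `D` of size `m + 1` looks close to each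
`D.erase x`, so `T` of every proper submonomial is nearly 1 at `D`. Testing on `∏ (1 - 2 x)` then
forces the norm. -/

/-! ### Free sets -/

open Finset in
/-- Kuratowski's free set theorem: a set mapping on the finite subsets of a set of cardinality at
least `ℵ_m` has a free set with `m + 1` elements. -/
theorem exists_free_finset {X : Type*} [DecidableEq X] (m : ℕ) :
    ∀ (F : Finset X → Finset X) (S : Set X), Cardinal.aleph (m : Ordinal) ≤ Cardinal.mk S →
      ∃ D : Finset X, (D : Set X) ⊆ S ∧ D.card = m + 1 ∧ ∀ x ∈ D, x ∉ F (D.erase x) := by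
  induction m with
  | zero =>
    intro F S hS
    have hinf : S.Infinite := by
      rw [← Set.infinite_coe_iff, Cardinal.infinite_iff]
      simpa using hS
    obtain ⟨x, hx, hxF⟩ := hinf.exists_notMem_finset (F ∅)
    refine ⟨{x}, by simpa using hx, by simp, ?_⟩
    intro y hy
    obtain rfl := Finset.mem_singleton.1 hy
    simpa using hxF
  | succ m ih =>
    classical
    intro F S hS
    have hlt : Cardinal.aleph (m : Ordinal) < Cardinal.aleph ((m + 1 : ℕ) : Ordinal) :=
      Cardinal.aleph_lt_aleph.2 (by exact_mod_cast Nat.lt_succ_self m)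
    obtain ⟨Y, hYS, hY⟩ := Cardinal.le_mk_iff_exists_subset.1 (hlt.le.trans hS)
    have hYinf : Infinite Y := by
      rw [Cardinal.infinite_iff, hY]
      exact Cardinal.aleph0_le_aleph _
    -- `U` has size at most `ℵ_m`, so some `x ∈ S` lies outside `Y` and every `F A` with `A ⊆ Y`
    -- finite. Induction inside `Y`, with `x` adjoined to each argument of `F`, supplies the other
    -- points.
    let U : Set X := Y ∪ ⋃ A : Finset Y, (F (A.map (Function.Embedding.subtype _)) : Set X)
    have hU : Cardinal.mk U < Cardinal.mk S := by
      refine lt_of_le_of_lt ?_ (hlt.trans_le hS)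
      refine (Cardinal.mk_union_le _ _).trans ?_
      refine Cardinal.add_le_of_le (Cardinal.aleph0_le_aleph _) hY.le ?_
      refine (Cardinal.mk_iUnion_le _).trans ?_
      rw [Cardinal.mk_finset_of_infinite, hY]
      refine Cardinal.mul_le_of_le (Cardinal.aleph0_le_aleph _) le_rfl ?_
      refine (ciSup_le' fun A => ?_).trans (Cardinal.aleph0_le_aleph _)
      exact (Cardinal.lt_aleph0_of_finite _).le
    obtain ⟨x, hxS, hxU⟩ : ∃ x ∈ S, x ∉ U := by
      by_contra! h
      exact absurd (Cardinal.mk_le_mk_of_subset h) (not_le.2 hU)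
    obtain ⟨D, hDY, hDc, hD⟩ := ih (fun A => F (insert x A)) Y hY.ge
    have hxY : x ∉ Y := fun h => hxU (Or.inl h)
    have hxD : x ∉ D := fun h => hxY (hDY h)
    refine ⟨insert x D, ?_, by rw [card_insert_of_notMem hxD, hDc], ?_⟩
    · intro y hy
      rcases Finset.mem_insert.1 hy with rfl | hy
      · exact hxS
      · exact hYS (hDY hy)
    · intro y hy
      rcases Finset.mem_insert.1 hy with rfl | hy
      · rw [erase_insert hxD]
        intro hF
        refine hxU (Or.inr (Set.mem_iUnion.2 ⟨D.subtype (· ∈ Y), ?_⟩))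
        rwa [Finset.subtype_map_of_mem fun z hz => hDY hz]
      · have hne : x ≠ y := fun h => hxD (h ▸ hy)
        rw [erase_insert_of_ne hne]
        exact hD y hy

/-! ### Points and monomials -/

/-- The characteristic function of a finite set with at most `n` elements, as a point of
`σ_n(2^X)`. -/
noncomputable def sigmaPoint {X : Type*} {n : ℕ} (A : Finset X) (hA : A.card ≤ n) :
    sigmaSpace n X :=
  ⟨(A : Set X).boolIndicator, A, by rw [Set.encard_coe_eq_coe_finsetCard]; exact_mod_cast hA, rfl⟩

theorem sigmaPoint_apply_eq_true {X : Type*} {n : ℕ} {A : Finset X} {hA : A.card ≤ n} {x : X} :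
    (sigmaPoint A hA).1 x = true ↔ x ∈ A :=
  (Set.mem_iff_boolIndicator (A : Set X) x).symm

theorem exists_sigmaPoint_eq {X : Type*} {n : ℕ} (g : sigmaSpace n X) :
    ∃ (A : Finset X) (hA : A.card ≤ n), g = sigmaPoint A hA := by
  obtain ⟨_, A, hA, rfl⟩ := g
  have hfin : A.Finite := Set.finite_of_encard_le_coe hA
  lift A to Finset X using hfin
  exact ⟨A, by rw [Set.encard_coe_eq_coe_finsetCard] at hA; exact_mod_cast hA, rfl⟩

theorem sigmaPoint_injective {X : Type*} {n : ℕ} {A B : Finset X} {hA : A.card ≤ n}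
    {hB : B.card ≤ n} (h : sigmaPoint A hA = sigmaPoint B hB) : A = B := by
  ext x
  rw [← sigmaPoint_apply_eq_true (hA := hA), h, sigmaPoint_apply_eq_true]

/-- The coordinate function at `x` on `σ_n(2^X)`, with real values. -/
noncomputable def sigmaCoord {X : Type*} (n : ℕ) (x : X) : C(sigmaSpace n X, ℝ) where
  toFun g := if g.1 x = true then 1 else 0
  continuous_toFun :=
    (continuous_of_discreteTopology (f := fun b : Bool => if b = true then (1 : ℝ) else 0)).comp
      ((continuous_apply x).comp continuous_subtype_val)

open Classical in
theorem prod_sigmaCoord_sigmaPoint {X : Type*} {n : ℕ} (S A : Finset X) (hA : A.card ≤ n) :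
    (∏ x ∈ S, sigmaCoord n x) (sigmaPoint A hA) = if S ⊆ A then 1 else 0 := by
  rw [ContinuousMap.prod_apply]
  simp only [sigmaCoord, ContinuousMap.coe_mk, sigmaPoint_apply_eq_true]
  rw [Finset.prod_ite_zero]
  simp [Finset.subset_iff]

open Classical in
theorem prod_sigmaCoord_mul {X : Type*} {n : ℕ} (S R : Finset X) :
    (∏ x ∈ S, sigmaCoord n x) * (∏ x ∈ R, sigmaCoord n x) = ∏ x ∈ S ∪ R, sigmaCoord n x := by
  ext g
  obtain ⟨A, hA, rfl⟩ := exists_sigmaPoint_eq g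
  rw [ContinuousMap.mul_apply]
  simp only [prod_sigmaCoord_sigmaPoint, Finset.union_subset_iff, ite_and, mul_ite, mul_one,
    mul_zero]
  split_ifs <;> rfl

/-- Coordinates are idempotent, so monomials form a monoid and their span is already a subalgebra;
Stone–Weierstrass applies. -/
theorem span_prod_sigmaCoord_dense {X : Type*} (n : ℕ) :
    (Submodule.span ℝ (Set.range fun S : Finset X => ∏ x ∈ S, sigmaCoord n x)).topologicalClosure
      = ⊤ := by
  classical
  let M : Submonoid C(sigmaSpace n X, ℝ) :=
    { carrier := Set.range fun S : Finset X => ∏ x ∈ S, sigmaCoord n x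
      one_mem' := ⟨∅, by simp⟩
      mul_mem' := by
        rintro _ _ ⟨S, rfl⟩ ⟨R, rfl⟩
        exact ⟨S ∪ R, (prod_sigmaCoord_mul S R).symm⟩ }
  have hsep : (Algebra.adjoin ℝ (M : Set C(sigmaSpace n X, ℝ))).SeparatesPoints := by
    intro g h hgh
    obtain ⟨x, hx⟩ : ∃ x, g.1 x ≠ h.1 x := by
      by_contra! H
      exact hgh (Subtype.ext (funext H))
    refine ⟨sigmaCoord n x, ⟨sigmaCoord n x, Algebra.subset_adjoin ⟨{x}, by simp⟩, rfl⟩, ?_⟩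
    simp only [sigmaCoord, ContinuousMap.coe_mk]
    cases hg : g.1 x <;> cases hh : h.1 x <;> simp_all
  have htop := ContinuousMap.subalgebra_topologicalClosure_eq_top_of_separatesPoints _ hsep
  have hspan : Subalgebra.toSubmodule (Algebra.adjoin ℝ (M : Set C(sigmaSpace n X, ℝ)))
      = Submodule.span ℝ (Set.range fun S : Finset X => ∏ x ∈ S, sigmaCoord n x) := by
    rw [Algebra.adjoin_eq_span, Submonoid.closure_eq]
    rfl
  rw [← hspan]
  ext f
  have hf : f ∈ (Algebra.adjoin ℝ (M : Set C(sigmaSpace n X, ℝ))).topologicalClosure := by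
    rw [htop]; trivial
  exact ⟨fun _ => trivial, fun _ => hf⟩

/-! ### The alternating extension -/

/-- The finite set whose characteristic function is a given point of `σ_n(2^X)`. -/
noncomputable def sigmaSupport {X : Type*} {n : ℕ} (g : sigmaSpace n X) : Finset X :=
  (exists_sigmaPoint_eq g).choose

theorem sigmaSupport_sigmaPoint {X : Type*} {n : ℕ} (A : Finset X) (hA : A.card ≤ n) :
    sigmaSupport (sigmaPoint A hA) = A :=
  (sigmaPoint_injective (exists_sigmaPoint_eq (sigmaPoint A hA)).choose_spec.choose_spec).symm

/-- The values of a function on `σ_m(2^X)` at finite sets, extended by zero. -/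
noncomputable def valueAt {X : Type*} {m : ℕ} (f : C(sigmaSpace m X, ℝ)) (A : Finset X) : ℝ :=
  if hA : A.card ≤ m then f (sigmaPoint A hA) else 0

open Classical in
/-- The extension of `f` to finite sets by an alternating sum over proper subsets. -/
noncomputable def alternatingExtension {X : Type*} {m : ℕ} (f : C(sigmaSpace m X, ℝ))
    (g : sigmaSpace (m + 1) X) : ℝ :=
  if (sigmaSupport g).card ≤ m then valueAt f (sigmaSupport g)
  else ∑ B ∈ (sigmaSupport g).ssubsets,
    (-1) ^ ((sigmaSupport g).card + B.card + 1) * valueAt f B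

theorem valueAt_add {X : Type*} {m : ℕ} (f f' : C(sigmaSpace m X, ℝ)) (A : Finset X) :
    valueAt (f + f') A = valueAt f A + valueAt f' A := by
  unfold valueAt; split_ifs <;> simp

theorem valueAt_smul {X : Type*} {m : ℕ} (c : ℝ) (f : C(sigmaSpace m X, ℝ)) (A : Finset X) :
    valueAt (c • f) A = c * valueAt f A := by
  unfold valueAt; split_ifs <;> simp

theorem abs_valueAt_le {X : Type*} {m : ℕ} (f : C(sigmaSpace m X, ℝ)) (A : Finset X) :
    |valueAt f A| ≤ ‖f‖ := by
  unfold valueAt; split_ifs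
  · exact f.norm_coe_le_norm _
  · simp

theorem alternatingExtension_add {X : Type*} {m : ℕ} (f f' : C(sigmaSpace m X, ℝ))
    (g : sigmaSpace (m + 1) X) :
    alternatingExtension (f + f') g = alternatingExtension f g + alternatingExtension f' g := by
  unfold alternatingExtension
  split_ifs
  · exact valueAt_add _ _ _
  · simp only [valueAt_add, mul_add, Finset.sum_add_distrib]

theorem alternatingExtension_smul {X : Type*} {m : ℕ} (c : ℝ) (f : C(sigmaSpace m X, ℝ))
    (g : sigmaSpace (m + 1) X) :
    alternatingExtension (c • f) g = c * alternatingExtension f g := by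
  unfold alternatingExtension
  split_ifs
  · exact valueAt_smul _ _ _
  · simp only [valueAt_smul, Finset.mul_sum, mul_left_comm]

theorem abs_alternatingExtension_le {X : Type*} {m : ℕ} (f : C(sigmaSpace m X, ℝ))
    (g : sigmaSpace (m + 1) X) :
    |alternatingExtension f g| ≤ (2 ^ (m + 1) - 1) * ‖f‖ := by
  classical
  obtain ⟨A, hA, rfl⟩ := exists_sigmaPoint_eq g
  unfold alternatingExtension
  rw [sigmaSupport_sigmaPoint]
  split_ifs with h
  · refine (abs_valueAt_le f A).trans (le_mul_of_one_le_left (norm_nonneg _) ?_)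
    have : (1 : ℝ) ≤ 2 ^ m := one_le_pow₀ (by norm_num)
    rw [pow_succ]; linarith
  · have hc : A.card = m + 1 := by omega
    refine (Finset.abs_sum_le_sum_abs _ _).trans ?_
    refine (Finset.sum_le_card_nsmul _ _ ‖f‖ fun B _ => ?_).trans (le_of_eq ?_)
    · rw [abs_mul, abs_pow, abs_neg, abs_one, one_pow, one_mul]
      exact abs_valueAt_le f B
    · have h1 : 1 ≤ 2 ^ (m + 1) := Nat.one_le_two_pow
      rw [Finset.ssubsets, Finset.card_erase_of_mem (Finset.mem_powerset_self A),
        Finset.card_powerset, hc, nsmul_eq_mul, Nat.cast_sub h1]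
      push_cast
      ring

open Classical in
theorem sum_powerset_neg_one_pow_card_of_ssubset {X : Type*} {S A : Finset X} (h : S ⊂ A) :
    ∑ B ∈ A.powerset, (-1 : ℝ) ^ B.card * (if S ⊆ B then 1 else 0) = 0 := by
  obtain ⟨x, hxA, hxS⟩ := Finset.exists_of_ssubset h
  -- Expanding this product over the set `B` of factors contributing `-1` gives the sum; the factor
  -- at `x ∉ S` is zero.
  have hprod : ∏ y ∈ A, ((-1 : ℝ) + if y ∉ S then 1 else 0) = 0 :=
    Finset.prod_eq_zero hxA (by simp [hxS])
  rw [Finset.prod_add] at hprod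
  rw [← hprod]
  refine Finset.sum_congr rfl fun B hB => ?_
  rw [Finset.prod_const, Finset.prod_ite_zero, Finset.prod_const_one]
  congr 2
  refine propext ⟨fun hS y hy hyS => (Finset.mem_sdiff.1 hy).2 (hS hyS), fun H y hy => ?_⟩
  by_contra hyB
  exact H y (Finset.mem_sdiff.2 ⟨h.1 hy, hyB⟩) hy

theorem valueAt_prod_sigmaCoord {X : Type*} [DecidableEq X] {m : ℕ} (S : Finset X) {B : Finset X}
    (hB : B.card ≤ m) :
    valueAt (∏ x ∈ S, sigmaCoord m x) B = if S ⊆ B then 1 else 0 := by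
  rw [valueAt, dif_pos hB, prod_sigmaCoord_sigmaPoint]
  congr

theorem alternatingExtension_prod_sigmaCoord {X : Type*} {m : ℕ} {S : Finset X}
    (hS : S.card ≤ m) (g : sigmaSpace (m + 1) X) :
    alternatingExtension (∏ x ∈ S, sigmaCoord m x) g = (∏ x ∈ S, sigmaCoord (m + 1) x) g := by
  classical
  obtain ⟨A, hA, rfl⟩ := exists_sigmaPoint_eq g
  rw [prod_sigmaCoord_sigmaPoint]
  unfold alternatingExtension
  rw [sigmaSupport_sigmaPoint]
  split_ifs with h hSA hSA
  · rw [valueAt_prod_sigmaCoord S h, if_pos hSA]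
  · rw [valueAt_prod_sigmaCoord S h, if_neg hSA]
  all_goals
    have hsum : ∑ B ∈ A.ssubsets,
        (-1 : ℝ) ^ (A.card + B.card + 1) * valueAt (∏ x ∈ S, sigmaCoord m x) B
        = (-1) ^ (A.card + 1) *
          ∑ B ∈ A.ssubsets, (-1 : ℝ) ^ B.card * (if S ⊆ B then 1 else 0) := by
      rw [Finset.mul_sum]
      refine Finset.sum_congr rfl fun B hB => ?_
      have := Finset.card_lt_card (Finset.mem_ssubsets.1 hB)
      rw [valueAt_prod_sigmaCoord S (by omega)]
      ring
    rw [hsum]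
  · have hss : S ⊂ A := by
      refine hSA.ssubset_of_ne ?_
      rintro rfl
      exact h hS
    have h0 := sum_powerset_neg_one_pow_card_of_ssubset hss
    rw [← Finset.sum_erase_add _ _ (Finset.mem_powerset_self A), if_pos hSA, mul_one] at h0
    rw [Finset.ssubsets, eq_neg_of_add_eq_zero_left h0]
    rw [pow_succ, mul_neg_one, neg_mul_neg, ← pow_add, ← two_mul, pow_mul]
    simp
  · rw [Finset.sum_eq_zero, mul_zero]
    intro B hB
    rw [if_neg fun hSB => hSA (hSB.trans (Finset.mem_ssubsets.1 hB).1), mul_zero]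

theorem continuous_alternatingExtension {X : Type*} {m : ℕ} (f : C(sigmaSpace m X, ℝ)) :
    Continuous (alternatingExtension f) := by
  have hspan : ∀ f ∈ Submodule.span ℝ (Set.range fun S : Finset X => ∏ x ∈ S, sigmaCoord m x),
      Continuous (alternatingExtension f) := by
    intro f hf
    have hzero : Continuous (alternatingExtension (0 : C(sigmaSpace m X, ℝ))) := by
      have : alternatingExtension (0 : C(sigmaSpace m X, ℝ)) = fun _ => 0 := by
        funext g
        simpa using alternatingExtension_smul 0 (0 : C(sigmaSpace m X, ℝ)) g
      rw [this]
      exact continuous_const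
    induction hf using Submodule.span_induction with
    | mem f hf =>
      obtain ⟨S, rfl⟩ := hf
      by_cases hS : S.card ≤ m
      · have := funext (alternatingExtension_prod_sigmaCoord hS)
        simp only [this]
        exact ContinuousMap.continuous _
      -- No set of size at most `m` contains `S`.
      · have : ∏ x ∈ S, sigmaCoord m x = 0 := by
          ext g
          obtain ⟨A, hA, rfl⟩ := exists_sigmaPoint_eq g
          rw [prod_sigmaCoord_sigmaPoint, if_neg fun h => hS ((Finset.card_le_card h).trans hA)]
          rfl
        simpa only [this] using hzero
    | zero => exact hzero
    | add f f' _ _ hf hf' =>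
      rw [funext (alternatingExtension_add f f')]
      exact hf.add hf'
    | smul c f _ hf =>
      rw [funext (alternatingExtension_smul c f)]
      exact continuous_const.mul hf
  refine continuous_of_uniform_approx_of_continuous fun u hu => ?_
  obtain ⟨ε, hε, hu⟩ := Metric.mem_uniformity_dist.1 hu
  have hC : (0 : ℝ) < 2 ^ (m + 1) := by positivity
  have hf : f ∈ closure ((Submodule.span ℝ
      (Set.range fun S : Finset X => ∏ x ∈ S, sigmaCoord m x) : Submodule ℝ _) :
        Set C(sigmaSpace m X, ℝ)) := by
    rw [← Submodule.topologicalClosure_coe, span_prod_sigmaCoord_dense]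
    trivial
  obtain ⟨f', hf', hd⟩ := Metric.mem_closure_iff.1 hf (ε / 2 ^ (m + 1)) (div_pos hε hC)
  refine ⟨alternatingExtension f', hspan f' hf', fun g => hu ?_⟩
  have hadd := alternatingExtension_add (f - f') f' g
  rw [sub_add_cancel] at hadd
  rw [Real.dist_eq, hadd, add_sub_cancel_right]
  refine (abs_alternatingExtension_le _ g).trans_lt ?_
  rw [dist_eq_norm, lt_div_iff₀ hC] at hd
  have := norm_nonneg (f - f')
  linarith

/-- The extension operator given by alternating sums over proper subsets. -/
noncomputable def alternatingExtensionCLM (m : ℕ) (X : Type*) :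
    C(sigmaSpace m X, ℝ) →L[ℝ] C(sigmaSpace (m + 1) X, ℝ) :=
  LinearMap.mkContinuous
    { toFun := fun f => ⟨alternatingExtension f, continuous_alternatingExtension f⟩
      map_add' := fun f f' => ContinuousMap.ext (alternatingExtension_add f f')
      map_smul' := fun c f => ContinuousMap.ext (alternatingExtension_smul c f) }
    (2 ^ (m + 1) - 1) fun f => by
      have h : (1 : ℝ) ≤ 2 ^ (m + 1) := one_le_pow₀ (by norm_num)
      exact (ContinuousMap.norm_le _ (mul_nonneg (by linarith) (norm_nonneg f))).2
        (abs_alternatingExtension_le f)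

theorem norm_alternatingExtensionCLM_le (m : ℕ) (X : Type*) :
    ‖alternatingExtensionCLM m X‖ ≤ 2 ^ (m + 1) - 1 := by
  have h : (1 : ℝ) ≤ 2 ^ (m + 1) := one_le_pow₀ (by norm_num)
  exact LinearMap.mkContinuous_norm_le _ (by linarith) _

theorem isExtensionOperator_alternatingExtensionCLM (m : ℕ) (X : Type*) :
    IsExtensionOperator (sigmaSpace_mono (Nat.le_succ m) X) (alternatingExtensionCLM m X) := by
  intro f g
  obtain ⟨A, hA, rfl⟩ := exists_sigmaPoint_eq g
  have : Set.inclusion (sigmaSpace_mono (Nat.le_succ m) X) (sigmaPoint A hA)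
      = sigmaPoint A (hA.trans (Nat.le_succ m)) := rfl
  rw [this]
  change alternatingExtension f _ = _
  unfold alternatingExtension
  rw [sigmaSupport_sigmaPoint, if_pos hA, valueAt, dif_pos hA]

/-! ### The lower bound -/

theorem exists_finset_forall_abs_sub_lt {X : Type*} [DecidableEq X] {n : ℕ}
    (f : C(sigmaSpace n X, ℝ)) (g : sigmaSpace n X) {ε : ℝ} (hε : 0 < ε) :
    ∃ F : Finset X, ∀ h : sigmaSpace n X, (∀ x ∈ F, h.1 x = g.1 x) → |f h - f g| < ε := by
  have hmem : {h : sigmaSpace n X | |f h - f g| < ε} ∈ nhds g :=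
    Metric.continuousAt_iff'.1 f.continuous.continuousAt ε hε
  rw [nhds_subtype_eq_comap, nhds_pi, Filter.mem_comap] at hmem
  obtain ⟨t, ht, hts⟩ := hmem
  obtain ⟨I, hI, s, hs, hst⟩ := Filter.mem_pi.1 ht
  refine ⟨hI.toFinset, fun h hh => hts (hst fun x hx => ?_)⟩
  rw [hh x (hI.mem_toFinset.2 hx)]
  exact mem_of_mem_nhds (hs x)

theorem le_norm_of_isExtensionOperator {X : Type*} (m : ℕ)
    (hX : Cardinal.aleph (m : Ordinal) ≤ Cardinal.mk X)
    (T : C(sigmaSpace m X, ℝ) →L[ℝ] C(sigmaSpace (m + 1) X, ℝ))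
    (hT : IsExtensionOperator (sigmaSpace_mono (Nat.le_succ m) X) T) :
    2 ^ (m + 1) - 1 ≤ ‖T‖ := by
  classical
  refine le_of_forall_pos_le_add fun δ hδ => ?_
  -- The total error is at most `ε` times the sum of `2 ^ C.card` over subsets `C` of `D`, which is
  -- `3 ^ (m + 1)`.
  obtain ⟨ε, hε, hεδ⟩ : ∃ ε : ℝ, 0 < ε ∧ 3 ^ (m + 1) * ε = δ :=
    ⟨δ / 3 ^ (m + 1), by positivity, by field_simp⟩
  have hloc : ∀ A : Finset X, ∃ F : Finset X, ∀ hA : A.card ≤ m, ∀ C ⊆ A,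
      ∀ h : sigmaSpace (m + 1) X, (∀ x ∈ F, h.1 x = true ↔ x ∈ A) →
        |T (∏ x ∈ C, sigmaCoord m x) h - 1| < ε := by
    intro A
    by_cases hA : A.card ≤ m
    swap
    · exact ⟨∅, fun h => absurd h hA⟩
    choose F hF using fun C : Finset X => exists_finset_forall_abs_sub_lt
      (T (∏ x ∈ C, sigmaCoord m x)) (sigmaPoint A (hA.trans (Nat.le_succ m))) hε
    refine ⟨A.powerset.biUnion F, fun _ C hC h hh => ?_⟩
    have h1 : T (∏ x ∈ C, sigmaCoord m x) (sigmaPoint A (hA.trans (Nat.le_succ m))) = 1 := by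
      have := hT (∏ x ∈ C, sigmaCoord m x) (sigmaPoint A hA)
      rw [prod_sigmaCoord_sigmaPoint, if_pos hC] at this
      exact this
    rw [← h1]
    refine hF C h fun x hx => ?_
    rw [Bool.eq_iff_iff, sigmaPoint_apply_eq_true]
    exact hh x (Finset.mem_biUnion.2 ⟨C, Finset.mem_powerset.2 hC, hx⟩)
  choose F hF using hloc
  obtain ⟨D, -, hDc, hD⟩ := exists_free_finset m F Set.univ (by simpa using hX)
  have hTC : ∀ C ∈ D.ssubsets,
      |T (∏ x ∈ C, sigmaCoord m x) (sigmaPoint D hDc.le) - 1| < ε := by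
    intro C hC
    -- `D` and `D.erase x` differ only at `x`, which freeness keeps out of `F (D.erase x)`.
    obtain ⟨x, hxD, hxC⟩ := Finset.exists_of_ssubset (Finset.mem_ssubsets.1 hC)
    have hcard : (D.erase x).card ≤ m := by rw [Finset.card_erase_of_mem hxD]; omega
    refine hF (D.erase x) hcard C
      (Finset.subset_erase.2 ⟨(Finset.mem_ssubsets.1 hC).1, hxC⟩) _ fun y hy => ?_
    have hyx : y ≠ x := by
      rintro rfl
      exact hD y hxD hy
    rw [sigmaPoint_apply_eq_true, Finset.mem_erase]
    exact ⟨fun h => ⟨hyx, h⟩, And.right⟩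
  -- A product of signs; its monomial coefficients `(-2) ^ C.card` sum over proper `C` to `±(2 ^ (m
  -- + 1) - 1)`.
  let f : C(sigmaSpace m X, ℝ) := ∏ x ∈ D, (1 + (-2 : ℝ) • sigmaCoord m x)
  have hfnorm : ‖f‖ ≤ 1 := by
    refine (ContinuousMap.norm_le _ zero_le_one).2 fun g => ?_
    rw [ContinuousMap.prod_apply, norm_prod]
    refine Finset.prod_le_one (fun _ _ => norm_nonneg _) fun x _ => ?_
    simp only [sigmaCoord, ContinuousMap.add_apply, ContinuousMap.one_apply,
      ContinuousMap.smul_apply, ContinuousMap.coe_mk]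
    split_ifs <;> norm_num
  have hzero : ∏ x ∈ D, sigmaCoord m x = 0 := by
    ext g
    obtain ⟨A, hA, rfl⟩ := exists_sigmaPoint_eq g
    rw [prod_sigmaCoord_sigmaPoint,
      if_neg fun h => absurd ((Finset.card_le_card h).trans hA) (by omega)]
    rfl
  have hf : f = ∑ C ∈ D.ssubsets, (-2 : ℝ) ^ C.card • ∏ x ∈ C, sigmaCoord m x := by
    have : f = ∑ C ∈ D.powerset, (-2 : ℝ) ^ C.card • ∏ x ∈ C, sigmaCoord m x := by
      simp only [f, Finset.prod_one_add, Finset.prod_smul, Finset.prod_const]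
    rw [this, ← Finset.sum_erase_add _ _ (Finset.mem_powerset_self D), hzero, smul_zero, add_zero]
    rfl
  have hsum : ∀ a : ℝ, ∑ C ∈ D.ssubsets, a ^ C.card = (a + 1) ^ (m + 1) - a ^ (m + 1) := by
    intro a
    have := Finset.sum_pow_mul_eq_add_pow a 1 D
    simp only [one_pow, mul_one] at this
    rw [← Finset.sum_erase_add _ _ (Finset.mem_powerset_self D), hDc] at this
    exact eq_sub_of_add_eq this
  have hTf : T f (sigmaPoint D hDc.le) - ((-1) ^ (m + 1) - (-2) ^ (m + 1)) =
      ∑ C ∈ D.ssubsets, (-2 : ℝ) ^ C.card *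
        (T (∏ x ∈ C, sigmaCoord m x) (sigmaPoint D hDc.le) - 1) := by
    have h2 := hsum (-2)
    norm_num only at h2
    simp only [mul_sub, mul_one, Finset.sum_sub_distrib]
    rw [h2, hf, map_sum, ContinuousMap.sum_apply]
    simp only [map_smul, ContinuousMap.smul_apply, smul_eq_mul]
  have hdiff : |T f (sigmaPoint D hDc.le) - ((-1) ^ (m + 1) - (-2) ^ (m + 1))| ≤ δ := by
    rw [hTf]
    refine (Finset.abs_sum_le_sum_abs _ _).trans ?_
    calc _ ≤ ∑ C ∈ D.ssubsets, (2 : ℝ) ^ C.card * ε := by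
          refine Finset.sum_le_sum fun C hC => ?_
          rw [abs_mul, abs_pow, abs_neg, abs_two]
          exact mul_le_mul_of_nonneg_left (hTC C hC).le (by positivity)
      _ = (3 ^ (m + 1) - 2 ^ (m + 1)) * ε := by
          rw [← Finset.sum_mul, hsum]; norm_num
      _ ≤ δ := by
          rw [← hεδ]
          have : (0 : ℝ) ≤ 2 ^ (m + 1) * ε := by positivity
          linarith
  have habs : |(-1 : ℝ) ^ (m + 1) - (-2) ^ (m + 1)| = 2 ^ (m + 1) - 1 := by
    have h1 : (1 : ℝ) ≤ 2 ^ (m + 1) := one_le_pow₀ (by norm_num)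
    have : (-1 : ℝ) ^ (m + 1) - (-2) ^ (m + 1) = (-1) ^ (m + 1) * (1 - 2 ^ (m + 1)) := by
      rw [mul_sub, mul_one, ← mul_pow]; norm_num
    rw [this, abs_mul, abs_pow, abs_neg, abs_one, one_pow, one_mul, abs_of_nonpos (by linarith)]
    ring
  have hTnorm : |T f (sigmaPoint D hDc.le)| ≤ ‖T‖ :=
    ((T f).norm_coe_le_norm _).trans (T.unit_le_opNorm f hfnorm)
  have := abs_sub_abs_le_abs_sub ((-1 : ℝ) ^ (m + 1) - (-2) ^ (m + 1)) (T f (sigmaPoint D hDc.le))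
  rw [abs_sub_comm] at hdiff
  linarith

theorem mainTheorem7 {X : Type*} (m : ℕ)
    (hX : Cardinal.aleph (m : Ordinal) ≤ Cardinal.mk X) :
    eta (sigmaSpace m X) (sigmaSpace (m + 1) X) (sigmaSpace_mono (Nat.le_succ m) X) =
      ENNReal.ofReal (2 ^ (m + 1) - 1) := by
  refine le_antisymm ?_ ?_
  · exact (iInf₂_le (alternatingExtensionCLM m X)
      (isExtensionOperator_alternatingExtensionCLM m X)).trans
        (ENNReal.ofReal_le_ofReal (norm_alternatingExtensionCLM_le m X))
  · exact le_iInf₂ fun T hT =>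
      ENNReal.ofReal_le_ofReal (le_norm_of_isExtensionOperator m hX T hT)
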